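/- Write $\hat\varphi$ for the Fourier transform of a tempered distribution $\varphi$ on $\mathbb{R}^3$, and let $\dot H^s(\mathbb{R}^3)$ be the space of locally integrable functions $\varphi$ on $\mathbb{R}^3$, real- or complex-valued, that define tempered distributions whose Fourier transform $\hat\varphi$ is a locally integrable function with $\|\varphi\|_{\dot H^s}^2=\int_{\mathbb{R}^3}|\xi|^{2s}|\hat\varphi(\xi)|^2\,d\xi<\infty$. Let $$\mathcal{E}^s=\Big\{\varphi\in\dot H^s(\mathbb{R}^3):\ \varphi\text{ is radial and }\iint_{\mathbb{R}^3\times\mathbb{R}^3}\frac{|\varphi(x)|^2|\varphi(y)|^2}{|x-y|}\,dx\,dy<\infty\Big\},$$ $$\|\varphi\|_{\mathcal{E}^s}=\Big(\|\varphi\|_{\dot H^s}^2+\Big(\iint_{\mathbb{R}^3\times\mathbb{R}^3}\frac{|\varphi(x)|^2|\varphi(y)|^2}{|x-y|}\,dx\,dy\Big)^{1/2}\Big)^{1/2}.$$ **Theorem 0.4.** Let $\tfrac12<s\le 1$ and $0<p<\frac{16s+2}{6s+1}$. Then $\mathcal{E}^s$ is not embedded in $L^p(\mathbb{R}^3)$.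 That is, $\mathcal{E}^s\not\subset L^p(\mathbb{R}^3)$; moreover, for every $C\ge 0$ there is $\varphi\in\mathcal{E}^s\cap L^p(\mathbb{R}^3)$ with $\|\varphi\|_{L^p}>C\,\|\varphi\|_{\mathcal{E}^s}$. -/

import Mathlib

open MeasureTheory
open scoped ENNReal NNReal SchwartzMap FourierTransform

/-- Three-dimensional Euclidean space. -/
abbrev E3 : Type := EuclideanSpace ℝ (Fin 3)

/-- The tempered distribution `T` is (given by integration against) the locally integrable
function `f`. -/
def IsRegularDistribution (T : 𝓢'(E3, ℂ)) (f : E3 → ℂ) : Prop :=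
  LocallyIntegrable f volume ∧
    ∀ ψ : 𝓢(E3, ℂ), Integrable (fun x => ψ x * f x) volume ∧ T ψ = ∫ x, ψ x * f x

/-- The squared homogeneous Sobolev norm `∫ |ξ|^{2s} |û(ξ)|² dξ` of a function `u`, where `û` is the
Fourier transform of `u` in the sense of tempered distributions and is required to be a locally
integrable function `g`. As `T` is determined by `u`, and `g` is determined almost everywhere
by `T`, the infimum is over at most one value; it is `∞` if there is no such `g`. -/
noncomputable def homSobolevSq (s : ℝ) (u : E3 → ℂ) : ℝ≥0∞ :=
  ⨅ (T : 𝓢'(E3, ℂ)) (g : E3 → ℂ) (_ : IsRegularDistribution T u)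
    (_ : IsRegularDistribution (𝓕 T) g), ∫⁻ ξ : E3, ‖ξ‖ₑ ^ (2 * s) * ‖g ξ‖ₑ ^ 2

section CoulombSobolev

variable {𝕜 : Type*} [RCLike 𝕜]

/-- `φ` is radially symmetric, as an element of a space of functions modulo null sets. -/
def IsRadial (φ : E3 → 𝕜) : Prop :=
  ∃ f : ℝ → 𝕜, φ =ᵐ[volume] fun x => f ‖x‖

/-- The homogeneous Sobolev norm of a scalar function; real-valued functions are regarded as
complex-valued ones. -/
noncomputable def homSobolevNorm (s : ℝ) (φ : E3 → 𝕜) : ℝ≥0∞ :=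
  homSobolevSq s (fun x => RCLike.map 𝕜 ℂ (φ x)) ^ (1 / 2 : ℝ)

/-- The Coulomb energy `∬ |φ(x)|² |φ(y)|² / |x - y| dx dy`. -/
noncomputable def coulombEnergy (φ : E3 → 𝕜) : ℝ≥0∞ :=
  ∫⁻ x : E3, ∫⁻ y : E3, ‖φ x‖ₑ ^ 2 * ‖φ y‖ₑ ^ 2 / ‖x - y‖ₑ

variable (𝕜) in
/-- The space of radial functions in the homogeneous Sobolev space of order `s` on `ℝ³` that have
finite Coulomb energy, as a set of representatives. -/
def coulombSobolev (s : ℝ) : Set (E3 → 𝕜) :=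
  {φ | AEStronglyMeasurable φ volume ∧ IsRadial φ ∧ homSobolevNorm s φ < ∞ ∧ coulombEnergy φ < ∞}

/-- The norm `(‖φ‖² + (∬ |φ(x)|² |φ(y)|² / |x - y| dx dy)^{1/2})^{1/2}` of the space
`coulombSobolev 𝕜 s`, the first norm being the homogeneous Sobolev norm. -/
noncomputable def coulombSobolevNorm (s : ℝ) (φ : E3 → 𝕜) : ℝ≥0∞ :=
  (homSobolevNorm s φ ^ 2 + coulombEnergy φ ^ (1 / 2 : ℝ)) ^ (1 / 2 : ℝ)

end CoulombSobolev

/-! The test functions are smooth radial bumps of height `a` on a shell of radius `R` and width `w`.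
The shell has volume of order `R²w`, so the squared Sobolev norm is at most of order `a²R²w^(1-2s)`,
the square root of the Coulomb energy at most of order `a²R^(3/2)w`, and `∫|u|^p` at least of order
`a^p R²w`. For `w = t`, `R = t^(4s)`, `a = t^(-(6s+1)/2)` the first two stay bounded, while the
third is at least a multiple of `t^(8s+1-(6s+1)p/2)`, a positive power exactly when `p <
(16s+2)/(6s+1)`. Large `t` then defeats any given constant.

A function outside `L^p` is a sum `∑ 2^(-k) u_k` of such bumps with `t_k` growing fast: the bumps
are nonnegative, so each one bounds the sum from below. The sum stays in the space because both
quantities are controlled by weighted `L²` norms: the Sobolev norm by definition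
(`homSobolevSq_tsum_le`), the Coulomb energy through the radial inequality
`exists_lintegral_coulomb_le`. The bounds for one bump rest on `lintegral_rpow_mul_fourier_le`. -/

/-! ### Polar coordinates and weights homogeneous of degree -1 -/

section Polar

variable {E : Type*} [NormedAddCommGroup E] [NormedSpace ℝ E] [FiniteDimensional ℝ E]
  [MeasurableSpace E] [BorelSpace E] [Nontrivial E] (μ : Measure E) [μ.IsAddHaarMeasure]

theorem integrableOn_norm_rpow_ball {q : ℝ} (hq : -(Module.finrank ℝ E : ℝ) < q) :
    IntegrableOn (fun x : E => ‖x‖ ^ q) (Metric.ball 0 1) μ := by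
  rw [integrableOn_fun_norm_addHaar μ (f := fun r : ℝ => r ^ q)]
  have hpos : 0 < Module.finrank ℝ E := Module.finrank_pos
  have h : IntegrableOn (fun r : ℝ => r ^ ((Module.finrank ℝ E : ℝ) - 1 + q)) (Set.Ioo 0 1) := by
    rw [intervalIntegral.integrableOn_Ioo_rpow_iff one_pos]
    linarith
  refine h.congr_fun (fun r hr => ?_) measurableSet_Ioo
  simp only [smul_eq_mul]
  rw [Real.rpow_add hr.1, ← Real.rpow_natCast, Nat.cast_sub (Nat.one_le_of_lt hpos), Nat.cast_one]

theorem lintegral_polar {F : E → ℝ≥0∞} (hF : Measurable F) :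
    ∫⁻ x, F x ∂μ = ∫⁻ ω, ∫⁻ r, F (r.1 • ω.1) ∂(Measure.volumeIoiPow (Module.finrank ℝ E - 1))
      ∂μ.toSphere := by
  have hm := (μ.measurePreserving_homeomorphUnitSphereProd).symm
    (homeomorphUnitSphereProd E).toMeasurableEquiv
  have hmeas : Measurable fun x : ({(0 : E)}ᶜ : Set E) => F x.1 := hF.comp measurable_subtype_coe
  have h0 : ∫⁻ x, F x ∂μ = ∫⁻ x in {(0 : E)}ᶜ, F x ∂μ := by rw [restrict_compl_singleton]
  rw [h0, ← lintegral_subtype_comap (measurableSet_singleton (0 : E)).compl,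
    ← hm.lintegral_comp hmeas, lintegral_prod]
  · refine lintegral_congr fun ω => lintegral_congr fun r => ?_
    congr 1
  · exact (hmeas.comp hm.measurable).aemeasurable

/-- On each ray the weight is `1/r` times its value on the unit sphere, so the integral factors. Two
such weights thus differ, on radial functions, only by their integrals over the sphere. -/
theorem lintegral_norm_mul_of_homogeneous {f : ℝ → ℝ≥0∞} (hf : Measurable f) {h : E → ℝ≥0∞}
    (hh : Measurable h) (hom : ∀ r : ℝ, 0 < r → ∀ x, h (r • x) = ENNReal.ofReal r⁻¹ * h x) :
    ∫⁻ x, f ‖x‖ * h x ∂μ = (∫⁻ ω, h ω.1 ∂μ.toSphere) *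
      ∫⁻ r, f r.1 * ENNReal.ofReal r.1⁻¹ ∂(Measure.volumeIoiPow (Module.finrank ℝ E - 1)) := by
  rw [lintegral_polar μ (by fun_prop), mul_comm, ← lintegral_const_mul _ (by fun_prop)]
  refine lintegral_congr fun ω => ?_
  rw [← lintegral_mul_const _ (by fun_prop)]
  refine lintegral_congr fun r => ?_
  have hr : 0 < r.1 := r.2
  rw [hom r.1 hr, norm_smul, mem_sphere_zero_iff_norm.1 ω.2, mul_one, Real.norm_of_nonneg hr.le]
  ring

/-- A weight which is homogeneous of degree `-1` and locally integrable acts on radial functions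
like a multiple of `1 / ‖x‖`. -/
theorem exists_lintegral_norm_mul_le_of_homogeneous {h : E → ℝ≥0∞} (hh : Measurable h)
    (hom : ∀ r : ℝ, 0 < r → ∀ x, h (r • x) = ENNReal.ofReal r⁻¹ * h x)
    (hfin : ∫⁻ x in Metric.ball 0 1, h x ∂μ < ∞) :
    ∃ K : ℝ≥0, ∀ f : ℝ → ℝ≥0∞, Measurable f →
      ∫⁻ x, f ‖x‖ * h x ∂μ ≤ K * ∫⁻ x, f ‖x‖ * ‖x‖ₑ⁻¹ ∂μ := by
  set ν := Measure.volumeIoiPow (Module.finrank ℝ E - 1)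
  set S := μ.toSphere Set.univ
  have hS : S ≠ 0 := by
    have : μ.toSphere ≠ 0 := μ.toSphere_ne_zero
    rwa [ne_eq, Measure.measure_univ_eq_zero]
  have hS' : S ≠ ∞ := measure_ne_top _ _
  set I := ∫⁻ ω, h ω.1 ∂μ.toSphere
  have hm : Measurable fun r : Set.Ioi (0 : ℝ) =>
      (Set.Iio (1 : ℝ)).indicator (1 : ℝ → ℝ≥0∞) r.1 * ENNReal.ofReal r.1⁻¹ :=
    ((measurable_one.indicator measurableSet_Iio).comp measurable_subtype_coe).mul (by fun_prop)
  -- Testing with the indicator of `r < 1` turns local integrability of `h` into finiteness on the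
  -- sphere, since the radial factor is not zero.
  have hI : I ≠ ∞ := by
    have key := lintegral_norm_mul_of_homogeneous μ
      (f := (Set.Iio 1).indicator 1) (measurable_one.indicator measurableSet_Iio) hh hom
    have e : ∫⁻ x, (Set.Iio (1 : ℝ)).indicator 1 ‖x‖ * h x ∂μ
        = ∫⁻ x in Metric.ball 0 1, h x ∂μ := by
      rw [← lintegral_indicator measurableSet_ball]
      refine lintegral_congr fun x => ?_
      by_cases hx : ‖x‖ < 1 <;> simp [hx]
    rw [e] at key
    intro hI
    rw [key] at hfin
    refine hfin.ne (ENNReal.mul_eq_top.2 (Or.inr ⟨hI, ?_⟩))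
    intro h0
    rw [lintegral_eq_zero_iff hm] at h0
    have : ν (Set.Iio ⟨1, Set.mem_Ioi.2 one_pos⟩) = 0 := by
      refine measure_mono_null ?_ h0
      intro r (hr : r < _)
      have hr1 : r.1 < 1 := hr
      have hr0 : 0 < r.1 := r.2
      simp [Set.indicator, hr1, hr0]
    rw [Measure.volumeIoiPow_apply_Iio] at this
    simp only [ENNReal.ofReal_eq_zero] at this
    exact absurd this (not_le.2 (by positivity))
  refine ⟨(I / S).toNNReal, fun f hf => ?_⟩
  rw [ENNReal.coe_toNNReal (ENNReal.div_ne_top hI hS), lintegral_norm_mul_of_homogeneous μ hf hh hom,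
    lintegral_norm_mul_of_homogeneous μ hf (h := fun x => ‖x‖ₑ⁻¹) (by fun_prop)]
  · have : ∫⁻ ω : Metric.sphere (0 : E) 1, ‖ω.1‖ₑ⁻¹ ∂μ.toSphere = S := by
      refine Eq.trans (lintegral_congr fun ω => ?_) lintegral_one
      rw [← ofReal_norm, mem_sphere_zero_iff_norm.1 ω.2]
      simp
    rw [this, ← mul_assoc, ENNReal.div_mul_cancel hS hS']
  · intro r hr x
    rw [enorm_smul, ENNReal.mul_inv (by simp [hr.ne']) (by simp), ENNReal.ofReal_inv_of_pos hr,
      Real.enorm_of_nonneg hr.le]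

end Polar

/-! ### The Coulomb energy of radial functions -/

theorem ENNReal.rpow_neg_le_rpow_neg {q : ℝ} (hq : 0 ≤ q) {a b : ℝ≥0∞} (h : a ≤ b) :
    b ^ (-q) ≤ a ^ (-q) := by
  rw [ENNReal.rpow_neg, ENNReal.rpow_neg]
  exact ENNReal.inv_le_inv.2 (ENNReal.rpow_le_rpow h hq)

theorem exists_linearIsometryEquiv_apply_eq {F : Type*} [NormedAddCommGroup F]
    [InnerProductSpace ℝ F] {v w : F} (h : ‖v‖ = ‖w‖) : ∃ L : F ≃ₗᵢ[ℝ] F, L v = w :=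
  ⟨_, Submodule.reflection_sub h⟩

/-- A weight on `ℝ³` that dominates `1 / |x - y|` for every `x` on the third axis. -/
noncomputable def axisWeight (y : E3) : ℝ≥0∞ :=
  ‖y 0‖ₑ ^ (-(1 / 2) : ℝ) * ‖y 1‖ₑ ^ (-(1 / 2) : ℝ)

theorem measurable_axisWeight : Measurable axisWeight := by
  unfold axisWeight
  fun_prop

theorem axisWeight_smul (r : ℝ) (hr : 0 < r) (x : E3) :
    axisWeight (r • x) = ENNReal.ofReal r⁻¹ * axisWeight x := by
  unfold axisWeight
  simp only [PiLp.smul_apply, smul_eq_mul, enorm_mul]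
  have h0 : ‖r‖ₑ ≠ 0 := by simp [hr.ne']
  have h1 : ‖r‖ₑ ≠ ∞ := by simp
  rw [ENNReal.mul_rpow_of_ne_top h1 enorm_ne_top, ENNReal.mul_rpow_of_ne_top h1 enorm_ne_top]
  have : ENNReal.ofReal r⁻¹ = ‖r‖ₑ ^ (-(1 / 2) : ℝ) * ‖r‖ₑ ^ (-(1 / 2) : ℝ) := by
    rw [← ENNReal.rpow_add _ _ h0 h1, ENNReal.ofReal_inv_of_pos hr, Real.enorm_of_nonneg hr.le]
    norm_num [ENNReal.rpow_neg_one]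
  rw [this]
  ring

/-- The ball lies in a cube, where the weight is a product of one-variable functions, and
`|t|^(-1/2)` is integrable near `0`. -/
theorem lintegral_axisWeight_ball_lt_top : ∫⁻ y in Metric.ball (0 : E3) 1, axisWeight y < ∞ := by
  let g : ℝ → ℝ := (Metric.ball 0 1).indicator fun t => ‖t‖ ^ (-(1 / 2) : ℝ)
  let k : Fin 3 → ℝ → ℝ := ![g, g, (Metric.ball 0 1).indicator 1]
  have hg : Integrable g := by
    rw [integrable_indicator_iff measurableSet_ball]
    exact integrableOn_norm_rpow_ball volume (by norm_num)
  have hk : Integrable fun x : Fin 3 → ℝ => ∏ i, k i (x i) := by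
    refine Integrable.fintype_prod fun i => ?_
    fin_cases i
    · exact hg
    · exact hg
    · exact (integrable_indicator_iff measurableSet_ball).2 (integrableOn_const (C := (1 : ℝ)) (by simp))
  have hne (i : Fin 3) : ∀ᵐ x : Fin 3 → ℝ, x i ≠ 0 :=
    (Measure.quasiMeasurePreserving_eval (fun _ : Fin 3 => (volume : Measure ℝ)) i).ae
      (Measure.ae_ne volume 0)
  rw [← lintegral_indicator measurableSet_ball,
    ← (PiLp.volume_preserving_toLp (Fin 3)).lintegral_comp
      (measurable_axisWeight.indicator measurableSet_ball)]
  refine lt_of_le_of_lt (lintegral_mono_ae ?_) hk.2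
  filter_upwards [hne 0, hne 1] with x h0 h1
  by_cases hx : WithLp.toLp 2 x ∈ Metric.ball (0 : E3) 1
  swap
  · simp only [Set.indicator_of_notMem hx, zero_le]
  rw [Set.indicator_of_mem hx]
  have hx' (i : Fin 3) : x i ∈ Metric.ball (0 : ℝ) 1 := by
    rw [mem_ball_zero_iff] at hx ⊢
    exact (PiLp.norm_apply_le (WithLp.toLp 2 x) i).trans_lt hx
  have hE (t : ℝ) (ht : t ≠ 0) : ‖t‖ₑ ^ (-(1 / 2) : ℝ) = ‖‖t‖ ^ (-(1 / 2) : ℝ)‖ₑ := by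
    rw [Real.enorm_of_nonneg (r := ‖t‖ ^ (-(1 / 2) : ℝ)) (by positivity),
      ← ENNReal.ofReal_rpow_of_pos (norm_pos_iff.2 ht), ofReal_norm]
  simp only [Fin.prod_univ_three, k, g, axisWeight, Matrix.cons_val_zero, Matrix.cons_val_one,
    Matrix.cons_val, Set.indicator_of_mem (hx' _), enorm_mul, Pi.one_apply, mul_one,
    hE _ h0, hE _ h1, le_refl]

/-- For a point on the third axis, the first two coordinates of the difference are those of `y` up
to sign. Each is at most the distance, and each absorbs half of the exponent -1. -/
theorem inv_enorm_sub_le_axisWeight (r : ℝ) (y : E3) :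
    ‖EuclideanSpace.single 2 r - y‖ₑ⁻¹ ≤ axisWeight y := by
  set z : E3 := EuclideanSpace.single 2 r - y
  have h0 : ‖y 0‖ₑ ≤ ‖z‖ₑ := by
    have := PiLp.norm_apply_le z 0
    rw [enorm_le_iff_norm_le]
    simpa [z] using this
  have h1 : ‖y 1‖ₑ ≤ ‖z‖ₑ := by
    have := PiLp.norm_apply_le z 1
    rw [enorm_le_iff_norm_le]
    simpa [z] using this
  have e : ‖z‖ₑ⁻¹ = ‖z‖ₑ ^ (-(1 / 2) : ℝ) * ‖z‖ₑ ^ (-(1 / 2) : ℝ) := by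
    rcases eq_or_ne ‖z‖ₑ 0 with h | h
    · simp [h]
    · rw [← ENNReal.rpow_add _ _ h enorm_ne_top]
      norm_num [ENNReal.rpow_neg_one]
  rw [e]
  exact mul_le_mul' (ENNReal.rpow_neg_le_rpow_neg (by norm_num) h0)
    (ENNReal.rpow_neg_le_rpow_neg (by norm_num) h1)

/-- A weak form of Newton's shell theorem. An isometry moves `x` to the third axis without changing
the radial `f`; there `axisWeight` dominates the kernel independently of `x`. -/
theorem exists_lintegral_radial_div_le : ∃ K : ℝ≥0, ∀ f : ℝ → ℝ≥0∞, Measurable f → ∀ x : E3,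
    ∫⁻ y : E3, f ‖y‖ * ‖x - y‖ₑ⁻¹ ≤ K * ∫⁻ y : E3, f ‖y‖ * ‖y‖ₑ⁻¹ := by
  obtain ⟨K, hK⟩ := exists_lintegral_norm_mul_le_of_homogeneous (volume : Measure E3)
    measurable_axisWeight axisWeight_smul lintegral_axisWeight_ball_lt_top
  refine ⟨K, fun f hf x => ?_⟩
  obtain ⟨L, hL⟩ := exists_linearIsometryEquiv_apply_eq
    (v := EuclideanSpace.single (2 : Fin 3) ‖x‖) (w := x) (by simp)
  rw [← L.measurePreserving.lintegral_comp (by fun_prop)]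
  refine le_trans (lintegral_mono fun y => ?_) (hK f hf)
  have : x - L y = L (EuclideanSpace.single (2 : Fin 3) ‖x‖ - y) := by rw [map_sub, hL]
  simp only [L.norm_map, this, L.enorm_map]
  gcongr
  exact inv_enorm_sub_le_axisWeight _ _

/-- By symmetry only the region `‖x‖ ≤ ‖y‖` matters. There the kernel may be replaced by `1/‖y‖`,
which is at most `‖x‖^(-1/2) ‖y‖^(-1/2)`, and the double integral separates. -/
theorem exists_lintegral_coulomb_le : ∃ K : ℝ≥0, ∀ f : ℝ → ℝ≥0∞, Measurable f →
    ∫⁻ x : E3, ∫⁻ y : E3, f ‖x‖ * f ‖y‖ / ‖x - y‖ₑ ≤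
      K * (∫⁻ x : E3, f ‖x‖ * ‖x‖ₑ ^ (-(1 / 2) : ℝ)) ^ 2 := by
  obtain ⟨K, hK⟩ := exists_lintegral_radial_div_le
  refine ⟨2 * K, fun f hf => ?_⟩
  set I := ∫⁻ x : E3, f ‖x‖ * ‖x‖ₑ ^ (-(1 / 2) : ℝ)
  obtain ⟨k, hk, hk_eq⟩ : ∃ k : E3 → E3 → ℝ≥0∞, Measurable (Function.uncurry k) ∧
      ∀ x y, k x y = if ‖x‖ ≤ ‖y‖ then f ‖x‖ * f ‖y‖ / ‖x - y‖ₑ else 0 := by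
    refine ⟨fun x y => if ‖x‖ ≤ ‖y‖ then f ‖x‖ * f ‖y‖ / ‖x - y‖ₑ else 0, ?_, fun _ _ => rfl⟩
    exact Measurable.ite (measurableSet_le (by fun_prop) (by fun_prop)) (by fun_prop)
      measurable_const
  have hle (x y : E3) : f ‖x‖ * f ‖y‖ / ‖x - y‖ₑ ≤ k x y + k y x := by
    rcases le_total ‖x‖ ‖y‖ with h | h
    · rw [hk_eq x y, if_pos h]
      exact le_self_add
    · rw [hk_eq y x, if_pos h, mul_comm (f ‖y‖), enorm_sub_rev y]
      exact le_add_self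
  have hhalf : ∫⁻ x, ∫⁻ y, k x y ≤ K * I ^ 2 := by
    have hx (x : E3) (hx : x ≠ 0) :
        ∫⁻ y, k x y ≤ f ‖x‖ * ‖x‖ₑ ^ (-(1 / 2) : ℝ) * (K * I) := by
      -- The truncation to `‖y‖ ≥ ‖x‖` is itself radial in `y`, so the shell bound applies to it.
      have hF := hK ((Set.Ici ‖x‖).indicator f) (hf.indicator measurableSet_Ici) x
      have e1 : ∫⁻ y, k x y = f ‖x‖ *
          ∫⁻ y : E3, (Set.Ici ‖x‖).indicator f ‖y‖ * ‖x - y‖ₑ⁻¹ := by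
        rw [← lintegral_const_mul]
        · refine lintegral_congr fun y => ?_
          by_cases h : ‖x‖ ≤ ‖y‖ <;> simp [hk_eq, h, div_eq_mul_inv, mul_assoc]
        · exact ((hf.indicator measurableSet_Ici).comp measurable_norm).mul (by fun_prop)
      have e2 : ∫⁻ y : E3, (Set.Ici ‖x‖).indicator f ‖y‖ * ‖y‖ₑ⁻¹ ≤
          ‖x‖ₑ ^ (-(1 / 2) : ℝ) * I := by
        rw [← lintegral_const_mul _ (by fun_prop)]
        refine lintegral_mono fun y => ?_
        by_cases h : ‖x‖ ≤ ‖y‖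
        · have h0 : ‖y‖ₑ ≠ 0 := by
            rw [enorm_ne_zero, ← norm_pos_iff]
            exact (norm_pos_iff.2 hx).trans_le h
          have e : ‖y‖ₑ⁻¹ = ‖y‖ₑ ^ (-(1 / 2) : ℝ) * ‖y‖ₑ ^ (-(1 / 2) : ℝ) := by
            rw [← ENNReal.rpow_add _ _ h0 enorm_ne_top]
            norm_num [ENNReal.rpow_neg_one]
          rw [Set.indicator_of_mem (show ‖y‖ ∈ Set.Ici ‖x‖ from h), e, mul_left_comm]
          gcongr ?_ * _
          exact ENNReal.rpow_neg_le_rpow_neg (by norm_num) (enorm_le_iff_norm_le.2 h)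
        · simp [h]
      calc ∫⁻ y, k x y ≤ f ‖x‖ * (K * (‖x‖ₑ ^ (-(1 / 2) : ℝ) * I)) := by
            rw [e1]
            gcongr
            exact hF.trans (by gcongr)
        _ = _ := by ring
    calc ∫⁻ x, ∫⁻ y, k x y ≤ ∫⁻ x, f ‖x‖ * ‖x‖ₑ ^ (-(1 / 2) : ℝ) * (K * I) := by
          refine lintegral_mono_ae ?_
          filter_upwards [Measure.ae_ne volume (0 : E3)] with x h using hx x h
      _ = I * (K * I) := lintegral_mul_const _ (by fun_prop)
      _ = _ := by ring
  calc ∫⁻ x : E3, ∫⁻ y : E3, f ‖x‖ * f ‖y‖ / ‖x - y‖ₑ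
      ≤ ∫⁻ x, ((∫⁻ y, k x y) + ∫⁻ y, k y x) := by
        refine lintegral_mono fun x => ?_
        rw [← lintegral_add_left hk.of_uncurry_left]
        exact lintegral_mono fun y => hle x y
    _ = (∫⁻ x, ∫⁻ y, k x y) + ∫⁻ x, ∫⁻ y, k y x :=
        lintegral_add_left hk.lintegral_prod_right' _
    _ = (∫⁻ x, ∫⁻ y, k x y) + ∫⁻ y, ∫⁻ x, k y x := by
        rw [lintegral_lintegral_swap (f := fun x y => k y x)]
        exact (hk.comp measurable_swap).aemeasurable
    _ ≤ K * I ^ 2 + K * I ^ 2 := add_le_add hhalf hhalf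
    _ = _ := by push_cast; ring

/-! ### Geometric superpositions and their Fourier transforms -/

theorem ENNReal.mul_le_sq_add_sq (a b : ℝ≥0∞) : a * b ≤ a ^ 2 + b ^ 2 := by
  rcases le_total a b with h | h
  · calc a * b ≤ b * b := by gcongr
      _ ≤ _ := by rw [← sq]; exact le_add_self
  · calc a * b ≤ a * a := by gcongr
      _ ≤ _ := by rw [← sq]; exact le_self_add

theorem ENNReal.tsum_geometric_mul_sq_le (a : ℕ → ℝ≥0∞) :
    (∑' k, (2⁻¹ : ℝ≥0∞) ^ k * a k) ^ 2 ≤ 4 * ∑' k, (2⁻¹ : ℝ≥0∞) ^ k * a k ^ 2 := by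
  have h2 : ∑' k, (2⁻¹ : ℝ≥0∞) ^ k = 2 := by simp [ENNReal.tsum_geometric]
  set S := ∑' k, (2⁻¹ : ℝ≥0∞) ^ k * a k ^ 2
  calc (∑' k, (2⁻¹ : ℝ≥0∞) ^ k * a k) ^ 2
      = ∑' j, ∑' k, (2⁻¹ : ℝ≥0∞) ^ j * a j * ((2⁻¹ : ℝ≥0∞) ^ k * a k) := by
        rw [sq, ← ENNReal.tsum_mul_right]
        simp_rw [← ENNReal.tsum_mul_left]
    _ ≤ ∑' j, ∑' k, ((2⁻¹ : ℝ≥0∞) ^ j * a j ^ 2 * (2⁻¹ : ℝ≥0∞) ^ k +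
          (2⁻¹ : ℝ≥0∞) ^ j * ((2⁻¹ : ℝ≥0∞) ^ k * a k ^ 2)) := by
        refine ENNReal.tsum_le_tsum fun j => ENNReal.tsum_le_tsum fun k => ?_
        calc (2⁻¹ : ℝ≥0∞) ^ j * a j * ((2⁻¹ : ℝ≥0∞) ^ k * a k)
            = (2⁻¹ : ℝ≥0∞) ^ j * (2⁻¹ : ℝ≥0∞) ^ k * (a j * a k) := by ring
          _ ≤ (2⁻¹ : ℝ≥0∞) ^ j * (2⁻¹ : ℝ≥0∞) ^ k * (a j ^ 2 + a k ^ 2) := by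
              gcongr
              exact ENNReal.mul_le_sq_add_sq _ _
          _ = _ := by ring
    _ = S * 2 + 2 * S := by
        simp_rw [ENNReal.tsum_add, ENNReal.tsum_mul_left, ENNReal.tsum_mul_right, h2, S]
    _ = 4 * S := by ring

/-- Uniform weighted `L²` bounds survive geometric superposition. This serves both the Sobolev
weight and the weight `‖x‖^(-1/2)` of the Coulomb bound. -/
theorem lintegral_mul_tsum_geometric_sq_le {α : Type*} [MeasurableSpace α] {μ : Measure α}
    {w : α → ℝ≥0∞} (hw : Measurable w) {F : ℕ → α → ℝ≥0∞} (hF : ∀ k, Measurable (F k))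
    {C : ℝ≥0∞} (hC : ∀ k, ∫⁻ x, w x * F k x ^ 2 ∂μ ≤ C) :
    ∫⁻ x, w x * (∑' k, (2⁻¹ : ℝ≥0∞) ^ k * F k x) ^ 2 ∂μ ≤ 8 * C := by
  calc ∫⁻ x, w x * (∑' k, (2⁻¹ : ℝ≥0∞) ^ k * F k x) ^ 2 ∂μ
      ≤ ∫⁻ x, 4 * ∑' k, (2⁻¹ : ℝ≥0∞) ^ k * (w x * F k x ^ 2) ∂μ := by
        refine lintegral_mono fun x => ?_
        calc w x * (∑' k, (2⁻¹ : ℝ≥0∞) ^ k * F k x) ^ 2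
            ≤ w x * (4 * ∑' k, (2⁻¹ : ℝ≥0∞) ^ k * F k x ^ 2) := by
              gcongr
              exact ENNReal.tsum_geometric_mul_sq_le _
          _ = 4 * ∑' k, (2⁻¹ : ℝ≥0∞) ^ k * (w x * F k x ^ 2) := by
              rw [mul_left_comm, ← ENNReal.tsum_mul_left]
              simp_rw [mul_left_comm]
    _ = 4 * ∑' k, (2⁻¹ : ℝ≥0∞) ^ k * ∫⁻ x, w x * F k x ^ 2 ∂μ := by
        rw [lintegral_const_mul _ (by fun_prop), lintegral_tsum (by fun_prop)]
        congr 2 with k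
        exact lintegral_const_mul _ (by fun_prop)
    _ ≤ 4 * ∑' k, (2⁻¹ : ℝ≥0∞) ^ k * C := by
        gcongr with k
        exact hC k
    _ = 8 * C := by
        have h2 : ∑' k, (2⁻¹ : ℝ≥0∞) ^ k = 2 := by simp [ENNReal.tsum_geometric]
        rw [ENNReal.tsum_mul_right, h2, ← mul_assoc]
        norm_num

/-- A weighted `L²` function pairs with bounded `L²` functions. -/
theorem lintegral_mul_lt_top_of_weighted_sq {s : ℝ} (hs0 : 0 < s) (hs : 2 * s < 3)
    {G χ : E3 → ℝ≥0∞} (hG : Measurable G) (hGs : ∫⁻ ξ, ‖ξ‖ₑ ^ (2 * s) * G ξ ^ 2 < ∞)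
    {M : ℝ≥0∞} (hM : M ≠ ∞) (hχM : ∀ ξ, χ ξ ≤ M) (hχ2 : ∫⁻ ξ, χ ξ ^ 2 < ∞) :
    ∫⁻ ξ, χ ξ * G ξ < ∞ := by
  -- Here `2s < 3` enters: `‖ξ‖^(-2s)` is integrable at the origin.
  have hball : ∫⁻ ξ in Metric.ball (0 : E3) 1, ‖ξ‖ₑ ^ (-(2 * s)) < ∞ := by
    have h := integrableOn_norm_rpow_ball (volume : Measure E3) (q := -(2 * s)) (by simp; linarith)
    refine lt_of_le_of_lt (lintegral_mono_ae ?_) h.2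
    filter_upwards [ae_restrict_of_ae (Measure.ae_ne volume (0 : E3))] with ξ h0
    rw [Real.enorm_of_nonneg (r := ‖ξ‖ ^ (-(2 * s))) (by positivity),
      ← ENNReal.ofReal_rpow_of_pos (norm_pos_iff.2 h0), ofReal_norm]
  have hneg : ∫⁻ ξ : E3, ‖ξ‖ₑ ^ (-(2 * s)) * χ ξ ^ 2 < ∞ := by
    calc ∫⁻ ξ : E3, ‖ξ‖ₑ ^ (-(2 * s)) * χ ξ ^ 2
        ≤ ∫⁻ ξ : E3, ((Metric.ball (0 : E3) 1).indicator
            (fun ξ => M ^ 2 * ‖ξ‖ₑ ^ (-(2 * s))) ξ + χ ξ ^ 2) := by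
          refine lintegral_mono fun ξ => ?_
          by_cases hξ : ξ ∈ Metric.ball (0 : E3) 1
          · rw [Set.indicator_of_mem hξ, mul_comm]
            refine le_trans ?_ le_self_add
            gcongr
            exact hχM ξ
          · refine le_trans ?_ le_add_self
            have h1 : (1 : ℝ≥0∞) ≤ ‖ξ‖ₑ := by
              rw [mem_ball_zero_iff, not_lt] at hξ
              rwa [← ofReal_norm, ENNReal.one_le_ofReal]
            calc ‖ξ‖ₑ ^ (-(2 * s)) * χ ξ ^ 2 ≤ 1 * χ ξ ^ 2 := by
                  gcongr
                  exact (ENNReal.rpow_neg_le_rpow_neg (by positivity) h1).trans (by simp)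
              _ = _ := one_mul _
      _ = M ^ 2 * (∫⁻ ξ in Metric.ball (0 : E3) 1, ‖ξ‖ₑ ^ (-(2 * s))) + ∫⁻ ξ, χ ξ ^ 2 := by
          rw [lintegral_add_left (Measurable.indicator (by fun_prop) measurableSet_ball),
            lintegral_indicator measurableSet_ball, lintegral_const_mul _ (by fun_prop)]
      _ < ∞ := ENNReal.add_lt_top.2
          ⟨ENNReal.mul_lt_top (ENNReal.pow_lt_top hM.lt_top) hball, hχ2⟩
  -- The product is split as `(‖ξ‖^s G) (‖ξ‖^(-s) χ)`.
  refine lt_of_le_of_lt (lintegral_mono_ae (g := fun ξ => ‖ξ‖ₑ ^ (2 * s) * G ξ ^ 2 +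
    ‖ξ‖ₑ ^ (-(2 * s)) * χ ξ ^ 2) ?_) ?_
  · filter_upwards [Measure.ae_ne volume (0 : E3)] with ξ h0
    have h0' : ‖ξ‖ₑ ≠ 0 := enorm_ne_zero.2 h0
    have e (q : ℝ) : ‖ξ‖ₑ ^ (2 * q) = (‖ξ‖ₑ ^ q) ^ 2 := by
      rw [mul_comm, ENNReal.rpow_mul]
      norm_num
    have e1 : ‖ξ‖ₑ ^ s * ‖ξ‖ₑ ^ (-s) = 1 := by
      rw [← ENNReal.rpow_add _ _ h0' enorm_ne_top]
      simp
    rw [neg_mul_eq_mul_neg, e, e, ← mul_pow, ← mul_pow]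
    refine le_trans (le_of_eq ?_) (ENNReal.mul_le_sq_add_sq _ _)
    rw [mul_mul_mul_comm, e1, one_mul, mul_comm]
  · rw [lintegral_add_left (by fun_prop)]
    exact ENNReal.add_lt_top.2 ⟨hGs, hneg⟩

theorem isRegularDistribution_tsum {u : ℕ → 𝓢(E3, ℂ)} (hb : ∀ k x, ‖u k x‖ ≤ 1) :
    ∃ T : 𝓢'(E3, ℂ), IsRegularDistribution T (fun x => ∑' k, (2⁻¹ : ℂ) ^ k * u k x) := by
  set φ : E3 → ℂ := fun x => ∑' k, (2⁻¹ : ℂ) ^ k * u k x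
  have hle (k : ℕ) (x : E3) : ‖(2⁻¹ : ℂ) ^ k * u k x‖ ≤ (2⁻¹ : ℝ) ^ k := by
    rw [norm_mul, norm_pow, norm_inv, Complex.norm_ofNat]
    exact mul_le_of_le_one_right (by positivity) (hb k x)
  have hsum : Summable fun k : ℕ => (2⁻¹ : ℝ) ^ k :=
    summable_geometric_of_lt_one (by norm_num) (by norm_num)
  have hcont : Continuous φ :=
    continuous_tsum (fun k => continuous_const.mul (u k).continuous) hsum hle
  have hmem : MemLp φ ∞ := memLp_top_of_bound hcont.aestronglyMeasurable _
    (.of_forall fun x => tsum_of_norm_bounded hsum.hasSum fun k => hle k x)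
  refine ⟨Lp.toTemperedDistribution hmem.toLp, hcont.locallyIntegrable, fun ψ => ⟨?_, ?_⟩⟩
  · exact MemLp.integrable_mul (p := 1) (q := ∞) (ψ.memLp 1) hmem
  · rw [Lp.toTemperedDistribution_apply]
    refine integral_congr_ae ?_
    filter_upwards [hmem.coeFn_toLp] with x hx
    rw [hx, smul_eq_mul]

/-- `homSobolevSq` is an infimum, so one admissible pair bounds it. The candidate for the transform
is the termwise one, `g`. Its majorant `G` is a weighted `L²` function, hence integrable against
Schwartz functions, which justifies exchanging sum and integral. -/
theorem homSobolevSq_tsum_le {s : ℝ} (hs0 : 0 < s) (hs : 2 * s < 3) {u : ℕ → 𝓢(E3, ℂ)}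
    (hb : ∀ k x, ‖u k x‖ ≤ 1) {C : ℝ≥0∞} (hC : C ≠ ∞)
    (hu : ∀ k, ∫⁻ ξ : E3, ‖ξ‖ₑ ^ (2 * s) * ‖𝓕 (u k) ξ‖ₑ ^ 2 ≤ C) :
    homSobolevSq s (fun x => ∑' k, (2⁻¹ : ℂ) ^ k * u k x) ≤ 8 * C := by
  obtain ⟨T, hT⟩ := isRegularDistribution_tsum hb
  let g : E3 → ℂ := fun ξ => ∑' k, (2⁻¹ : ℂ) ^ k * 𝓕 (u k) ξ
  let G : E3 → ℝ≥0∞ := fun ξ => ∑' k, (2⁻¹ : ℝ≥0∞) ^ k * ‖𝓕 (u k) ξ‖ₑ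
  have hmeas (k : ℕ) : Measurable fun ξ => 𝓕 (u k) ξ := (𝓕 (u k)).continuous.measurable
  have hGm : Measurable G := Measurable.tsum fun k => by
    have := hmeas k
    fun_prop
  have hgm : Measurable g := Measurable.tsum fun k => by
    have := hmeas k
    fun_prop
  have henorm (k : ℕ) (z : ℂ) : ‖(2⁻¹ : ℂ) ^ k * z‖ₑ = (2⁻¹ : ℝ≥0∞) ^ k * ‖z‖ₑ := by
    rw [enorm_mul, enorm_pow, enorm_inv (by norm_num), ← ofReal_norm, Complex.norm_ofNat]
    simp
  have hgG (ξ : E3) : ‖g ξ‖ₑ ≤ G ξ := by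
    refine enorm_tsum_le_tsum_enorm.trans (le_of_eq ?_)
    simp only [henorm, G]
  have hGs : ∫⁻ ξ : E3, ‖ξ‖ₑ ^ (2 * s) * G ξ ^ 2 ≤ 8 * C :=
    lintegral_mul_tsum_geometric_sq_le (by fun_prop) (fun k => (hmeas k).enorm) hu
  have hGs' := hGs.trans_lt (ENNReal.mul_lt_top (by simp) hC.lt_top)
  have hψG (ψ : 𝓢(E3, ℂ)) : ∫⁻ ξ, ‖ψ ξ‖ₑ * G ξ < ∞ := by
    refine lintegral_mul_lt_top_of_weighted_sq hs0 hs hGm hGs'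
      (M := ENNReal.ofReal (SchwartzMap.seminorm ℝ 0 0 ψ)) ENNReal.ofReal_ne_top (fun ξ => ?_) ?_
    · rw [← ofReal_norm]
      exact ENNReal.ofReal_le_ofReal (ψ.norm_le_seminorm ℝ ξ)
    · have := (eLpNorm_lt_top_iff_lintegral_rpow_enorm_lt_top (by norm_num) (by norm_num)).1
        (ψ.memLp 2 volume).2
      simpa using this
  have hgT : IsRegularDistribution (𝓕 T) g := by
    refine ⟨?_, fun ψ => ⟨⟨?_, ?_⟩, ?_⟩⟩
    · rw [locallyIntegrable_iff]
      intro K hK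
      refine ⟨hgm.aestronglyMeasurable, ?_⟩
      have := lintegral_mul_lt_top_of_weighted_sq hs0 hs hGm hGs' (χ := K.indicator 1) (M := 1) (by simp)
        (fun ξ => Set.indicator_le_self' (by simp) ξ) (by
          refine lt_of_le_of_lt (lintegral_mono (g := K.indicator 1) fun ξ => ?_) ?_
          · by_cases h : ξ ∈ K <;> simp [h]
          · rw [lintegral_indicator_one hK.measurableSet]
            exact hK.measure_lt_top)
      refine lt_of_le_of_lt ?_ this
      rw [← lintegral_indicator hK.measurableSet]
      refine lintegral_mono fun ξ => ?_
      by_cases h : ξ ∈ K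
      · simpa [h] using hgG ξ
      · simp [h]
    · exact ψ.continuous.aestronglyMeasurable.mul hgm.aestronglyMeasurable
    · refine lt_of_le_of_lt (lintegral_mono fun ξ => ?_) (hψG ψ)
      rw [enorm_mul]
      gcongr
      exact hgG ξ
    · rw [TemperedDistribution.fourier_apply, (hT.2 _).2]
      have hl : ∫ x, 𝓕 ψ x * ∑' k, (2⁻¹ : ℂ) ^ k * u k x
          = ∑' k, ∫ x, (2⁻¹ : ℂ) ^ k * (𝓕 ψ x * u k x) := by
        rw [← integral_tsum]
        · refine integral_congr_ae (.of_forall fun x => ?_)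
          simp only
          rw [← tsum_mul_left]
          simp_rw [mul_left_comm]
        · intro k
          exact (((𝓕 ψ).continuous.mul (u k).continuous).const_mul _).aestronglyMeasurable
        · have hI : ∫⁻ x, ‖𝓕 ψ x‖ₑ < ∞ := (𝓕 ψ).integrable.2
          have hle (k : ℕ) : ∫⁻ x, ‖(2⁻¹ : ℂ) ^ k * (𝓕 ψ x * u k x)‖ₑ
              ≤ (2⁻¹ : ℝ≥0∞) ^ k * ∫⁻ x, ‖𝓕 ψ x‖ₑ := by
            rw [← lintegral_const_mul _ (𝓕 ψ).continuous.measurable.enorm]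
            refine lintegral_mono fun x => ?_
            rw [henorm, enorm_mul]
            gcongr
            refine mul_le_of_le_one_right' ?_
            rw [← ofReal_norm, ENNReal.ofReal_le_one]
            exact hb k x
          refine ne_top_of_le_ne_top ?_ (ENNReal.tsum_le_tsum hle)
          rw [ENNReal.tsum_mul_right, ENNReal.tsum_geometric]
          exact ENNReal.mul_ne_top (by simp) hI.ne
      have hr : ∫ ξ, ψ ξ * g ξ = ∑' k, ∫ ξ, (2⁻¹ : ℂ) ^ k * (ψ ξ * 𝓕 (u k) ξ) := by
        rw [← integral_tsum]
        · refine integral_congr_ae (.of_forall fun ξ => ?_)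
          simp only [g]
          rw [← tsum_mul_left]
          simp_rw [mul_left_comm]
        · intro k
          exact ((ψ.continuous.mul (𝓕 (u k)).continuous).const_mul _).aestronglyMeasurable
        · rw [← lintegral_tsum]
          · refine ne_of_lt (lt_of_le_of_lt (le_of_eq ?_) (hψG ψ))
            refine lintegral_congr fun ξ => ?_
            simp only [G, ← ENNReal.tsum_mul_left, henorm, enorm_mul]
            simp_rw [mul_left_comm]
          · intro k
            exact ((ψ.continuous.mul (𝓕 (u k)).continuous).const_mul _).measurable.enorm.aemeasurable
      rw [hl, hr]
      congr 1 with k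
      simp_rw [integral_const_mul]
      rw [SchwartzMap.integral_fourier_mul_eq]
  refine le_trans (iInf_le_of_le T <| iInf_le_of_le g <| iInf_le_of_le hT <| iInf_le_of_le hgT
    le_rfl) (le_trans (lintegral_mono fun ξ => ?_) hGs)
  gcongr
  exact hgG ξ

/-! ### Sobolev bounds at a given length scale -/

section Frequency

open LineDeriv

theorem SchwartzMap.lintegral_enorm_sq_fourier {V H : Type*} [NormedAddCommGroup V]
    [InnerProductSpace ℝ V] [FiniteDimensional ℝ V] [MeasurableSpace V] [BorelSpace V]
    [NormedAddCommGroup H] [InnerProductSpace ℂ H] [CompleteSpace H] (f : 𝓢(V, H)) :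
    ∫⁻ ξ, ‖𝓕 f ξ‖ₑ ^ 2 = ∫⁻ x, ‖f x‖ₑ ^ 2 := by
  have key (g : 𝓢(V, H)) : ∫⁻ x, ‖g x‖ₑ ^ 2 = ENNReal.ofReal (∫ x, ‖g x‖ ^ 2) := by
    rw [ofReal_integral_eq_lintegral_ofReal]
    · refine lintegral_congr fun x => ?_
      rw [← ofReal_norm, ENNReal.ofReal_pow (norm_nonneg _)]
    · exact (g.memLp 2 volume).integrable_norm_pow (by norm_num)
    · exact .of_forall fun x => by positivity
  rw [key, key, SchwartzMap.integral_norm_sq_fourier]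

theorem lintegral_enorm_sq_mul_fourier_le (u : 𝓢(E3, ℂ)) :
    ∫⁻ ξ : E3, ‖ξ‖ₑ ^ 2 * ‖𝓕 u ξ‖ₑ ^ 2 ≤
      ∑ j : Fin 3, ∫⁻ x, ‖∂_{(EuclideanSpace.single j (1 : ℝ) : E3)} u x‖ₑ ^ 2 := by
  have hcomp (j : Fin 3) (ξ : E3) :
      ‖ξ j‖ₑ * ‖𝓕 u ξ‖ₑ ≤ ‖𝓕 (∂_{(EuclideanSpace.single j (1 : ℝ) : E3)} u) ξ‖ₑ := by
    have htg : (inner ℝ · (EuclideanSpace.single j (1 : ℝ) : E3)).HasTemperateGrowth := by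
      fun_prop
    rw [SchwartzMap.fourier_lineDerivOp_eq, smul_apply,
      SchwartzMap.smulLeftCLM_apply_apply htg, enorm_smul, enorm_smul]
    -- The factor `2π` from differentiation only helps and is discarded.
    have h1 : (1 : ℝ≥0∞) ≤ ‖(2 * Real.pi * Complex.I : ℂ)‖ₑ := by
      rw [← ofReal_norm, ENNReal.one_le_ofReal]
      simp only [norm_mul, Complex.norm_ofNat, Complex.norm_real, Complex.norm_I, mul_one,
        Real.norm_of_nonneg Real.pi_pos.le]
      linarith [Real.pi_gt_three]
    have h2 : inner ℝ ξ (EuclideanSpace.single j (1 : ℝ) : E3) = ξ j := by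
      simp [EuclideanSpace.inner_single_right]
    rw [h2]
    exact le_mul_of_one_le_left' h1
  calc ∫⁻ ξ : E3, ‖ξ‖ₑ ^ 2 * ‖𝓕 u ξ‖ₑ ^ 2
      = ∫⁻ ξ : E3, ∑ j : Fin 3, (‖ξ j‖ₑ * ‖𝓕 u ξ‖ₑ) ^ 2 := by
        refine lintegral_congr fun ξ => ?_
        have : ‖ξ‖ₑ ^ 2 = ∑ j : Fin 3, ‖ξ j‖ₑ ^ 2 := by
          rw [← ofReal_norm, ← ENNReal.ofReal_pow (norm_nonneg _), EuclideanSpace.norm_sq_eq,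
            ENNReal.ofReal_sum_of_nonneg fun _ _ => by positivity]
          refine Finset.sum_congr rfl fun j _ => ?_
          rw [ENNReal.ofReal_pow (norm_nonneg _), ofReal_norm]
        simp_rw [this, Finset.sum_mul, mul_pow]
    _ ≤ ∫⁻ ξ : E3, ∑ j : Fin 3, ‖𝓕 (∂_{(EuclideanSpace.single j (1 : ℝ) : E3)} u) ξ‖ₑ ^ 2 := by
        gcongr with ξ j
        exact hcomp j ξ
    _ = _ := by
        rw [lintegral_finsetSum]
        · simp_rw [SchwartzMap.lintegral_enorm_sq_fourier]
        · intro j _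
          exact (SchwartzMap.continuous _).measurable.enorm.pow_const 2

/-- The frequency `1/w` separates the two cases; the first term dominates below it, the second
above. -/
theorem rpow_two_mul_le {s : ℝ} (hs0 : 0 ≤ s) (hs1 : s ≤ 1) {w r : ℝ} (hw : 0 < w) (hr : 0 ≤ r) :
    r ^ (2 * s) ≤ w ^ (-(2 * s)) + w ^ (2 - 2 * s) * r ^ 2 := by
  rcases le_total r w⁻¹ with h | h
  · calc r ^ (2 * s) ≤ w⁻¹ ^ (2 * s) := by gcongr
      _ = w ^ (-(2 * s)) := by rw [Real.inv_rpow hw.le, Real.rpow_neg hw.le]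
      _ ≤ _ := le_add_of_nonneg_right (by positivity)
  · have hr0 : 0 < r := (inv_pos.2 hw).trans_le h
    have h1 : 1 ≤ w * r := by
      rwa [inv_le_iff_one_le_mul₀ hw, mul_comm] at h
    calc r ^ (2 * s) ≤ r ^ (2 * s) * (w * r) ^ (2 - 2 * s) :=
          le_mul_of_one_le_right (by positivity) (Real.one_le_rpow h1 (by linarith))
      _ = w ^ (2 - 2 * s) * r ^ 2 := by
          rw [Real.mul_rpow hw.le hr, mul_left_comm, ← Real.rpow_add hr0, add_sub_cancel,
            Real.rpow_two]
      _ ≤ _ := le_add_of_nonneg_left (by positivity)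

/-- Interpolation between `L²` and the gradient at the length scale `w`. -/
theorem lintegral_rpow_mul_fourier_le {s : ℝ} (hs0 : 0 ≤ s) (hs1 : s ≤ 1) {w : ℝ} (hw : 0 < w)
    (u : 𝓢(E3, ℂ)) :
    ∫⁻ ξ : E3, ‖ξ‖ₑ ^ (2 * s) * ‖𝓕 u ξ‖ₑ ^ 2 ≤
      ENNReal.ofReal (w ^ (-(2 * s))) * (∫⁻ x, ‖u x‖ₑ ^ 2) +
      ENNReal.ofReal (w ^ (2 - 2 * s)) *
        ∑ j : Fin 3, ∫⁻ x, ‖∂_{(EuclideanSpace.single j (1 : ℝ) : E3)} u x‖ₑ ^ 2 := by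
  have hm : Measurable fun ξ => ‖𝓕 u ξ‖ₑ := (𝓕 u).continuous.measurable.enorm
  calc ∫⁻ ξ : E3, ‖ξ‖ₑ ^ (2 * s) * ‖𝓕 u ξ‖ₑ ^ 2
      ≤ ∫⁻ ξ : E3, (ENNReal.ofReal (w ^ (-(2 * s))) * ‖𝓕 u ξ‖ₑ ^ 2 +
          ENNReal.ofReal (w ^ (2 - 2 * s)) * (‖ξ‖ₑ ^ 2 * ‖𝓕 u ξ‖ₑ ^ 2)) := by
        refine lintegral_mono fun ξ => ?_
        simp only
        rw [← mul_assoc, ← add_mul]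
        refine mul_le_mul_left ?_ _
        rw [← ofReal_norm, ENNReal.ofReal_rpow_of_nonneg (norm_nonneg _) (by positivity),
          ← ENNReal.ofReal_pow (norm_nonneg _), ← ENNReal.ofReal_mul (by positivity),
          ← ENNReal.ofReal_add (by positivity) (by positivity)]
        exact ENNReal.ofReal_le_ofReal (rpow_two_mul_le hs0 hs1 hw (norm_nonneg _))
    _ = ENNReal.ofReal (w ^ (-(2 * s))) * (∫⁻ ξ, ‖𝓕 u ξ‖ₑ ^ 2) +
          ENNReal.ofReal (w ^ (2 - 2 * s)) * ∫⁻ ξ : E3, ‖ξ‖ₑ ^ 2 * ‖𝓕 u ξ‖ₑ ^ 2 := by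
        rw [lintegral_add_left (by fun_prop), lintegral_const_mul _ (by fun_prop),
          lintegral_const_mul _ (by fun_prop)]
    _ ≤ _ := by
        rw [SchwartzMap.lintegral_enorm_sq_fourier]
        exact add_le_add le_rfl (mul_le_mul' le_rfl (lintegral_enorm_sq_mul_fourier_le u))

end Frequency

/-! ### Smooth radial bumps on spherical shells -/

section Shell

/-- A closed spherical shell. -/
def shell (r₁ r₂ : ℝ) : Set E3 := {x | r₁ ≤ ‖x‖ ∧ ‖x‖ ≤ r₂}

theorem measurableSet_shell (r₁ r₂ : ℝ) : MeasurableSet (shell r₁ r₂) :=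
  (measurableSet_le measurable_const measurable_norm).inter
    (measurableSet_le measurable_norm measurable_const)

theorem volume_shell {r₁ r₂ : ℝ} (h₁ : 0 ≤ r₁) (h : r₁ ≤ r₂) :
    volume (shell r₁ r₂) =
      ENNReal.ofReal (r₂ ^ 3 - r₁ ^ 3) * volume (Metric.ball (0 : E3) 1) := by
  have e : shell r₁ r₂ = Metric.closedBall 0 r₂ \ Metric.ball 0 r₁ := by
    ext x
    simp [shell, and_comm]
  rw [e, measure_sdiff ((Metric.ball_subset_ball h).trans Metric.ball_subset_closedBall)
    measurableSet_ball.nullMeasurableSet measure_ball_lt_top.ne,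
    Measure.addHaar_closedBall _ _ (h₁.trans h), Measure.addHaar_ball _ _ h₁,
    finrank_euclideanSpace_fin, ← ENNReal.sub_mul (fun _ _ => measure_ball_lt_top.ne),
    ENNReal.ofReal_sub _ (by positivity)]

theorem volume_shell_le {R w : ℝ} (hw : 0 < w) (hwR : w ≤ R / 2) :
    volume (shell (R - w) (R + w)) ≤
      ENNReal.ofReal (7 * (R ^ 2 * w)) * volume (Metric.ball (0 : E3) 1) := by
  rw [volume_shell (by linarith) (by linarith)]
  gcongr
  nlinarith [mul_pos hw hw, mul_nonneg hw.le (mul_nonneg hw.le (sub_nonneg.2 hwR)),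
    mul_nonneg hw.le (mul_nonneg (sub_nonneg.2 hwR) (sub_nonneg.2 hwR)), pow_pos hw 3]

theorem le_volume_shell {R w : ℝ} (hw : 0 < w) (hR : 0 < R) :
    ENNReal.ofReal (3 / 8 * (R ^ 2 * w)) * volume (Metric.ball (0 : E3) 1) ≤
      volume (shell R (R + w / 8)) := by
  rw [volume_shell hR.le (by linarith)]
  gcongr
  nlinarith [mul_pos hR (mul_pos hw hw), pow_pos hw 3]

/-- A smooth cutoff on the line, equal to `1` on `[-1/2, 1/2]` and supported in `[-1, 1]`. -/
noncomputable def lineBump : ContDiffBump (0 : ℝ) where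
  rIn := 1 / 2
  rOut := 1
  rIn_pos := by norm_num
  rIn_lt_rOut := by norm_num

theorem lineBump_eq_zero {t : ℝ} (ht : 1 ≤ |t|) : lineBump t = 0 :=
  lineBump.zero_of_le_dist (by simpa [lineBump] using ht)

theorem lineBump_eq_one {t : ℝ} (ht : |t| ≤ 1 / 2) : lineBump t = 1 :=
  lineBump.one_of_mem_closedBall (by simpa [lineBump] using ht)

theorem deriv_lineBump_eq_zero {t : ℝ} (ht : 1 < |t|) : deriv lineBump t = 0 := by
  have : lineBump =ᶠ[nhds t] fun _ => (0 : ℝ) := by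
    filter_upwards [(isOpen_lt continuous_const continuous_abs).mem_nhds ht] with y hy
    exact lineBump_eq_zero (le_of_lt hy)
  rw [this.deriv_eq, deriv_const]

theorem exists_deriv_lineBump_bound : ∃ D : ℝ, ∀ t, ‖deriv lineBump t‖ ≤ D :=
  (lineBump.hasCompactSupport.deriv).exists_bound_of_continuous
    (lineBump.contDiff.continuous_deriv (n := 1) le_rfl)

/-- The profile of a smooth radial bump at radius `R` of width `w` and height `a`. -/
noncomputable def shellProfile (a R w r : ℝ) : ℝ := a * lineBump ((r ^ 2 - R ^ 2) / (R * w))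

variable {a R w : ℝ}

theorem continuous_shellProfile : Continuous (shellProfile a R w) := by
  have : Continuous lineBump := lineBump.continuous
  unfold shellProfile
  fun_prop

theorem shellProfile_nonneg (ha : 0 ≤ a) (r : ℝ) : 0 ≤ shellProfile a R w r :=
  mul_nonneg ha lineBump.nonneg

theorem shellProfile_le (ha : 0 ≤ a) (r : ℝ) : shellProfile a R w r ≤ a :=
  mul_le_of_le_one_right ha lineBump.le_one

theorem mem_shell_of_abs_le (hw : 0 < w) (hwR : w ≤ R / 2) {x : E3}
    (hx : |(‖x‖ ^ 2 - R ^ 2) / (R * w)| ≤ 1) : x ∈ shell (R - w) (R + w) := by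
  have hR : 0 < R := by linarith
  rw [abs_div, abs_of_pos (mul_pos hR hw), div_le_one (mul_pos hR hw), abs_le] at hx
  constructor
  · refine abs_le_of_sq_le_sq' ?_ (norm_nonneg x) |>.2
    nlinarith
  · refine abs_le_of_sq_le_sq' ?_ (by linarith) |>.2
    nlinarith

theorem shellProfile_eq_zero (hw : 0 < w) (hwR : w ≤ R / 2) {x : E3}
    (hx : x ∉ shell (R - w) (R + w)) : shellProfile a R w ‖x‖ = 0 := by
  rw [shellProfile, lineBump_eq_zero, mul_zero]
  by_contra! h
  exact hx (mem_shell_of_abs_le hw hwR h.le)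

theorem shellProfile_eq (hw : 0 < w) (hwR : w ≤ R / 2) {x : E3} (hx : x ∈ shell R (R + w / 8)) :
    shellProfile a R w ‖x‖ = a := by
  have hR : 0 < R := by linarith
  rw [shellProfile, lineBump_eq_one, mul_one]
  rw [abs_div, abs_of_pos (mul_pos hR hw), div_le_iff₀ (mul_pos hR hw), abs_le]
  obtain ⟨h1, h2⟩ := hx
  constructor <;> nlinarith

/-- The profile depends on `‖x‖²`, which is smooth at the origin as well. -/
theorem contDiff_shellProfile_norm :
    ContDiff ℝ (⊤ : ℕ∞) fun x : E3 => shellProfile a R w ‖x‖ := by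
  unfold shellProfile
  exact contDiff_const.mul
    (lineBump.contDiff.comp (((contDiff_norm_sq ℝ).sub contDiff_const).div_const _))

theorem hasCompactSupport_shellProfile_norm (hw : 0 < w) (hwR : w ≤ R / 2) :
    HasCompactSupport fun x : E3 => shellProfile a R w ‖x‖ := by
  refine HasCompactSupport.intro (isCompact_closedBall 0 (R + w)) fun x hx => ?_
  refine shellProfile_eq_zero hw hwR fun h => hx ?_
  simpa using h.2

/-- The chain rule gives at most `aD · 2‖x‖/(Rw)`, and `‖x‖ ≤ 3R/2` on the shell. -/
theorem norm_fderiv_shellProfile_norm_le (hw : 0 < w) (hwR : w ≤ R / 2) (ha : 0 ≤ a) {D : ℝ}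
    (hD : ∀ t, ‖deriv lineBump t‖ ≤ D) (x : E3) :
    ‖fderiv ℝ (fun x : E3 => shellProfile a R w ‖x‖) x‖ ≤
      (shell (R - w) (R + w)).indicator (fun _ => 3 * D * a / w) x := by
  have hR : 0 < R := by linarith
  have hD0 : 0 ≤ D := (norm_nonneg _).trans (hD 0)
  set q : ℝ := (‖x‖ ^ 2 - R ^ 2) / (R * w)
  have hq : HasFDerivAt (fun x : E3 => (‖x‖ ^ 2 - R ^ 2) / (R * w))
      ((R * w)⁻¹ • (2 • innerSL ℝ x)) x := by
    simpa [div_eq_mul_inv, mul_comm] using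
      (((hasStrictFDerivAt_norm_sq x).hasFDerivAt.sub_const (R ^ 2)).const_mul (R * w)⁻¹)
  have hη : HasDerivAt lineBump (deriv lineBump q) q :=
    ((lineBump.contDiff (n := 1)).differentiable (by norm_num)).differentiableAt.hasDerivAt
  have hv : HasFDerivAt (fun x : E3 => shellProfile a R w ‖x‖)
      (a • (deriv lineBump q • ((R * w)⁻¹ • (2 • innerSL ℝ x)))) x :=
    (HasDerivAt.comp_hasFDerivAt (h₂ := lineBump) x hη hq).const_mul a
  rw [hv.fderiv]
  by_cases hx : x ∈ shell (R - w) (R + w)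
  · rw [Set.indicator_of_mem hx, norm_smul, norm_smul, norm_smul, ← Nat.cast_smul_eq_nsmul ℝ, norm_smul,
      innerSL_apply_norm, Real.norm_of_nonneg ha, Real.norm_of_nonneg (r := (R * w)⁻¹)
      (by positivity)]
    have hx2 : ‖x‖ ≤ 3 / 2 * R := by linarith [hx.2]
    calc a * (‖deriv lineBump q‖ * ((R * w)⁻¹ * (‖((2 : ℕ) : ℝ)‖ * ‖x‖)))
        ≤ a * (D * ((R * w)⁻¹ * (2 * (3 / 2 * R)))) := by
          have : ‖((2 : ℕ) : ℝ)‖ = 2 := by norm_num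
          rw [this]
          gcongr
          exact hD q
      _ = 3 * D * a / w := by
          field_simp
  · have : deriv lineBump q = 0 := by
      refine deriv_lineBump_eq_zero ?_
      by_contra! h
      exact hx (mem_shell_of_abs_le hw hwR h)
    rw [this, zero_smul, smul_zero, norm_zero]
    exact Set.indicator_nonneg (fun _ _ => by positivity) x

end Shell

-- The bump has size at most `a` and gradient of order at most `a/w`, both carried by a shell of
-- volume of order `R²w`. Interpolation at the scale `w` gives the Sobolev bound.
open LineDeriv in
theorem exists_shellProfile_bounds {s : ℝ} (hs0 : 0 ≤ s) (hs1 : s ≤ 1) :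
    ∃ C : ℝ≥0, ∃ c : ℝ, 0 < c ∧ ∀ a R w : ℝ, 0 ≤ a → 0 < w → w ≤ R / 2 → ∃ u : 𝓢(E3, ℂ),
      (∀ x, u x = shellProfile a R w ‖x‖) ∧
      ∫⁻ ξ : E3, ‖ξ‖ₑ ^ (2 * s) * ‖𝓕 u ξ‖ₑ ^ 2 ≤
        C * ENNReal.ofReal (a ^ 2 * R ^ 2 * w * w ^ (-(2 * s))) ∧
      ∫⁻ x : E3, ‖x‖ₑ ^ (-(1 / 2) : ℝ) * ‖u x‖ₑ ^ 2 ≤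
        C * ENNReal.ofReal (a ^ 2 * R ^ 2 * w * R ^ (-(1 / 2) : ℝ)) ∧
      ∀ p : ℝ, 0 < p →
        ENNReal.ofReal (c * (a ^ p * (R ^ 2 * w))) ≤ ∫⁻ x : E3, ‖u x‖ₑ ^ p := by
  obtain ⟨D, hD⟩ := exists_deriv_lineBump_bound
  set V := volume (Metric.ball (0 : E3) 1)
  have hVtop : V ≠ ∞ := measure_ball_lt_top.ne
  have hV0 : V ≠ 0 := (Metric.measure_ball_pos volume (0 : E3) one_pos).ne'
  have hVr : V = ENNReal.ofReal V.toReal := (ENNReal.ofReal_toReal hVtop).symm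
  have hVpos : 0 < V.toReal := ENNReal.toReal_pos hV0 hVtop
  -- `7` comes from the volume of the shell; `189 = 3 · 3² · 7` from three derivatives of size
  -- `3Da/w`; `14 = 2 · 7` from `(R/4)^(-1/2) = 2R^(-1/2)`. The `3/8` comes from the thinner shell
  -- on which the bump equals `a`.
  refine ⟨((7 + 14 + 189 * D ^ 2) * V.toReal).toNNReal, 3 / 8 * V.toReal, by positivity,
    fun a R w ha hw hwR => ?_⟩
  have hR : 0 < R := by linarith
  set A := shell (R - w) (R + w)
  have hA : MeasurableSet A := measurableSet_shell _ _
  have hAV : volume A ≤ ENNReal.ofReal (7 * (R ^ 2 * w) * V.toReal) := by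
    rw [ENNReal.ofReal_mul (by positivity), ← hVr]
    exact volume_shell_le hw hwR
  have hcd : ContDiff ℝ (⊤ : ℕ∞) fun x : E3 => (shellProfile a R w ‖x‖ : ℂ) :=
    Complex.ofRealCLM.contDiff.comp contDiff_shellProfile_norm
  have hcs : HasCompactSupport fun x : E3 => (shellProfile a R w ‖x‖ : ℂ) :=
    (hasCompactSupport_shellProfile_norm hw hwR).comp_left (g := ((↑) : ℝ → ℂ)) (by simp)
  let u : 𝓢(E3, ℂ) := hcs.toSchwartzMap hcd
  have hu (x : E3) : u x = shellProfile a R w ‖x‖ := rfl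
  have hu_enorm (x : E3) : ‖u x‖ₑ = ENNReal.ofReal (shellProfile a R w ‖x‖) := by
    rw [hu, ← ofReal_norm, Complex.norm_real, Real.norm_of_nonneg (shellProfile_nonneg ha _)]
  -- a function bounded by a constant on the shell and vanishing off it
  have hsq {f : E3 → ℝ≥0∞} {b : ℝ} (hf : ∀ x, f x ≤ A.indicator (fun _ => ENNReal.ofReal b) x) :
      ∫⁻ x, f x ≤ ENNReal.ofReal b * ENNReal.ofReal (7 * (R ^ 2 * w) * V.toReal) := by
    refine (lintegral_mono hf).trans ?_
    rw [lintegral_indicator_const hA]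
    gcongr
  have hu_sq (x : E3) : ‖u x‖ₑ ^ 2 ≤ A.indicator (fun _ => ENNReal.ofReal (a ^ 2)) x := by
    by_cases hx : x ∈ A
    · rw [Set.indicator_of_mem hx, hu_enorm, ENNReal.ofReal_pow ha]
      gcongr
      exact shellProfile_le ha _
    · rw [hu_enorm, shellProfile_eq_zero hw hwR hx]
      simp
  have hdu (j : Fin 3) (x : E3) : ‖∂_{(EuclideanSpace.single j (1 : ℝ) : E3)} u x‖ₑ ^ 2 ≤
      A.indicator (fun _ => ENNReal.ofReal ((3 * D * a / w) ^ 2)) x := by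
    have hfd : fderiv ℝ u x =
        Complex.ofRealCLM.comp (fderiv ℝ (fun x : E3 => shellProfile a R w ‖x‖) x) := by
      have hd : DifferentiableAt ℝ (fun x : E3 => shellProfile a R w ‖x‖) x :=
        (contDiff_shellProfile_norm.differentiable (by simp)).differentiableAt
      exact (Complex.ofRealCLM.hasFDerivAt.comp x hd.hasFDerivAt).fderiv
    have hn : ‖∂_{(EuclideanSpace.single j (1 : ℝ) : E3)} u x‖ ≤
        A.indicator (fun _ => 3 * D * a / w) x := by
      rw [SchwartzMap.lineDerivOp_apply_eq_fderiv, hfd, ContinuousLinearMap.comp_apply,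
        Complex.ofRealCLM_apply, Complex.norm_real]
      refine (ContinuousLinearMap.le_opNorm _ _).trans ?_
      rw [PiLp.norm_single, norm_one, mul_one]
      exact norm_fderiv_shellProfile_norm_le hw hwR ha hD x
    rw [← ofReal_norm, ← ENNReal.ofReal_pow (norm_nonneg _)]
    by_cases hx : x ∈ A
    · rw [Set.indicator_of_mem hx] at hn ⊢
      gcongr
    · rw [Set.indicator_of_notMem hx] at hn ⊢
      rw [le_antisymm hn (norm_nonneg _)]
      simp
  have hC (b : ℝ) : ((((7 + 14 + 189 * D ^ 2) * V.toReal).toNNReal : ℝ≥0) : ℝ≥0∞) *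
      ENNReal.ofReal b = ENNReal.ofReal ((7 + 14 + 189 * D ^ 2) * V.toReal * b) := by
    rw [ENNReal.ofReal_mul (by positivity)]
    rfl
  refine ⟨u, hu, ?_, ?_, fun p hp => ?_⟩
  · refine (lintegral_rpow_mul_fourier_le hs0 hs1 hw u).trans ?_
    rw [hC]
    calc _ ≤ ENNReal.ofReal (w ^ (-(2 * s))) *
            (ENNReal.ofReal (a ^ 2) * ENNReal.ofReal (7 * (R ^ 2 * w) * V.toReal)) +
          ENNReal.ofReal (w ^ (2 - 2 * s)) * ∑ _j : Fin 3,
            (ENNReal.ofReal ((3 * D * a / w) ^ 2) *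
              ENNReal.ofReal (7 * (R ^ 2 * w) * V.toReal)) :=
          add_le_add (mul_le_mul' le_rfl (hsq hu_sq))
            (mul_le_mul' le_rfl (Finset.sum_le_sum fun j _ => hsq (hdu j)))
      _ = ENNReal.ofReal (w ^ (-(2 * s)) * (a ^ 2 * (7 * (R ^ 2 * w) * V.toReal)) +
          w ^ (2 - 2 * s) * (3 * ((3 * D * a / w) ^ 2 * (7 * (R ^ 2 * w) * V.toReal)))) := by
          rw [Finset.sum_const, Finset.card_univ, Fintype.card_fin, nsmul_eq_mul,
            ← ENNReal.ofReal_mul (by positivity), ← ENNReal.ofReal_mul (by positivity),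
            ← ENNReal.ofReal_mul (by positivity), ← ENNReal.ofReal_natCast,
            ← ENNReal.ofReal_mul (by positivity), ← ENNReal.ofReal_mul (by positivity),
            ← ENNReal.ofReal_add (by positivity) (by positivity)]
          norm_num
      _ ≤ _ := by
          refine ENNReal.ofReal_le_ofReal ?_
          have e : w ^ (2 - 2 * s) = w ^ 2 * w ^ (-(2 * s)) := by
            rw [sub_eq_add_neg, Real.rpow_add hw, Real.rpow_two]
          rw [e]
          have e2 : w ^ (-(2 * s)) * (a ^ 2 * (7 * (R ^ 2 * w) * V.toReal)) +
              w ^ 2 * w ^ (-(2 * s)) * (3 * ((3 * D * a / w) ^ 2 * (7 * (R ^ 2 * w) * V.toReal)))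
              = (7 + 189 * D ^ 2) * V.toReal * (a ^ 2 * R ^ 2 * w * w ^ (-(2 * s))) := by
            field_simp
            ring
          rw [e2]
          gcongr
          linarith
  · have hhalf (x : E3) : ‖x‖ₑ ^ (-(1 / 2) : ℝ) * ‖u x‖ₑ ^ 2 ≤
        A.indicator (fun _ => ENNReal.ofReal (2 * R ^ (-(1 / 2) : ℝ) * a ^ 2)) x := by
      by_cases hx : x ∈ A
      · have h1 := hu_sq x
        rw [Set.indicator_of_mem hx] at h1 ⊢
        rw [ENNReal.ofReal_mul (by positivity)]
        refine mul_le_mul' ?_ h1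
        have h4 : R / 4 ≤ ‖x‖ := le_trans (by linarith) hx.1
        calc ‖x‖ₑ ^ (-(1 / 2) : ℝ) ≤ ENNReal.ofReal (R / 4) ^ (-(1 / 2) : ℝ) := by
              refine ENNReal.rpow_neg_le_rpow_neg (by norm_num) ?_
              rw [← ofReal_norm]
              exact ENNReal.ofReal_le_ofReal h4
          _ = ENNReal.ofReal (2 * R ^ (-(1 / 2) : ℝ)) := by
              rw [ENNReal.ofReal_rpow_of_pos (by positivity), Real.div_rpow hR.le (by norm_num)]
              congr 1
              have : (4 : ℝ) ^ (-(1 / 2) : ℝ) = 1 / 2 := by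
                rw [show (4 : ℝ) = 2 ^ (2 : ℝ) by norm_num, ← Real.rpow_mul (by norm_num)]
                norm_num [Real.rpow_neg_one]
              rw [this]
              ring
      · rw [hu_enorm, shellProfile_eq_zero hw hwR hx]
        simp
    refine (hsq hhalf).trans ?_
    rw [hC, ← ENNReal.ofReal_mul (by positivity)]
    refine ENNReal.ofReal_le_ofReal ?_
    calc 2 * R ^ (-(1 / 2) : ℝ) * a ^ 2 * (7 * (R ^ 2 * w) * V.toReal)
        = 14 * V.toReal * (a ^ 2 * R ^ 2 * w * R ^ (-(1 / 2) : ℝ)) := by ring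
      _ ≤ _ := by
          gcongr
          nlinarith [sq_nonneg D]
  · calc ENNReal.ofReal (3 / 8 * V.toReal * (a ^ p * (R ^ 2 * w)))
        = ENNReal.ofReal (a ^ p) * (ENNReal.ofReal (3 / 8 * (R ^ 2 * w)) * V) := by
          rw [hVr, ← ENNReal.ofReal_mul (by positivity), ← ENNReal.ofReal_mul (by positivity),
            ENNReal.toReal_ofReal hVpos.le]
          congr 1
          ring
      _ ≤ ENNReal.ofReal (a ^ p) * volume (shell R (R + w / 8)) := by
          gcongr
          exact le_volume_shell hw hR
      _ = ∫⁻ x, (shell R (R + w / 8)).indicator (fun _ => ENNReal.ofReal (a ^ p)) x :=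
          (lintegral_indicator_const (measurableSet_shell _ _) _).symm
      _ ≤ _ := by
          refine lintegral_mono fun x => ?_
          by_cases hx : x ∈ shell R (R + w / 8)
          · rw [Set.indicator_of_mem hx, hu_enorm, shellProfile_eq hw hwR hx,
              ENNReal.ofReal_rpow_of_nonneg ha hp.le]
          · simp [hx]

/-- Radial bumps that are bounded in the Coulomb–Sobolev norm, and large in `L^p` for
subcritical `p`. -/
theorem exists_radial_bumps {s : ℝ} (hs : 1 / 2 < s) (hs1 : s ≤ 1) :
    ∃ C : ℝ≥0, ∃ c : ℝ, 0 < c ∧ ∀ t : ℝ, 2 ≤ t → ∃ (u : 𝓢(E3, ℂ)) (v : ℝ → ℝ),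
      Continuous v ∧ (∀ r, 0 ≤ v r) ∧ (∀ r, v r ≤ 1) ∧ (∀ x, u x = v ‖x‖) ∧
      ∫⁻ ξ : E3, ‖ξ‖ₑ ^ (2 * s) * ‖𝓕 u ξ‖ₑ ^ 2 ≤ C ∧
      ∫⁻ x : E3, ‖x‖ₑ ^ (-(1 / 2) : ℝ) * ‖u x‖ₑ ^ 2 ≤ C ∧
      ∀ p : ℝ, 0 < p →
        ENNReal.ofReal (c * t ^ (8 * s + 1 - (6 * s + 1) / 2 * p)) ≤ ∫⁻ x : E3, ‖u x‖ₑ ^ p := by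
  obtain ⟨C, c, hc, h⟩ := exists_shellProfile_bounds (s := s) (by linarith) hs1
  refine ⟨C, c, hc, fun t ht => ?_⟩
  have ht0 : 0 < t := by linarith
  -- With `w = t`, these exponents solve `a²R²w^(1-2s) = 1` and `a²R^(3/2)w = 1`.
  set a := t ^ (-((6 * s + 1) / 2))
  set R := t ^ (4 * s)
  have ha : 0 ≤ a := by positivity
  have ha1 : a ≤ 1 := Real.rpow_le_one_of_one_le_of_nonpos (by linarith) (by linarith)
  -- `s > 1/2` gives `t² ≤ t^(4s)`: the shell is thin compared with its radius.
  have htR : t ≤ R / 2 := by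
    have h2 : t ^ (2 : ℝ) ≤ R := Real.rpow_le_rpow_of_exponent_le (by linarith) (by linarith)
    rw [Real.rpow_two] at h2
    nlinarith
  obtain ⟨u, hu, h1, h2, h3⟩ := h a R t ha ht0 htR
  have ea : a ^ 2 = t ^ (-(6 * s + 1)) := by
    rw [← Real.rpow_natCast, ← Real.rpow_mul ht0.le]
    congr 1
    push_cast
    ring
  have eR : R ^ 2 = t ^ (8 * s) := by
    rw [← Real.rpow_natCast, ← Real.rpow_mul ht0.le]
    congr 1
    push_cast
    ring
  refine ⟨u, shellProfile a R t, continuous_shellProfile, shellProfile_nonneg ha,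
    fun r => (shellProfile_le ha r).trans ha1, hu, ?_, ?_, fun p hp => ?_⟩
  · have : a ^ 2 * R ^ 2 * t * t ^ (-(2 * s)) = 1 := by
      rw [ea, eR]
      nth_rw 3 [← Real.rpow_one t]
      rw [← Real.rpow_add ht0, ← Real.rpow_add ht0, ← Real.rpow_add ht0]
      ring_nf
      simp
    simpa [this] using h1
  · have : a ^ 2 * R ^ 2 * t * R ^ (-(1 / 2) : ℝ) = 1 := by
      rw [ea, eR, ← Real.rpow_mul ht0.le]
      nth_rw 3 [← Real.rpow_one t]
      rw [← Real.rpow_add ht0, ← Real.rpow_add ht0, ← Real.rpow_add ht0]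
      ring_nf
      simp
    simpa only [this, ENNReal.ofReal_one, mul_one] using h2
  · refine le_trans (le_of_eq ?_) (h3 p hp)
    rw [eR, ← Real.rpow_mul ht0.le]
    nth_rw 4 [← Real.rpow_one t]
    rw [← Real.rpow_add ht0, ← Real.rpow_add ht0]
    congr 3
    ring

/-! ### Superpositions of bumps and failure of the embedding -/

theorem RCLike.map_ofReal {𝕜 𝕂 : Type*} [RCLike 𝕜] [RCLike 𝕂] (r : ℝ) :
    RCLike.map 𝕜 𝕂 (r : 𝕜) = (r : 𝕂) := by
  simp [RCLike.map]

/-- Geometric superpositions of uniformly bounded radial bumps lie in the Coulomb–Sobolev space. -/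
theorem exists_mem_coulombSobolev_enorm_eq_tsum (𝕜 : Type*) [RCLike 𝕜] {s : ℝ} (hs0 : 0 < s)
    (hs : 2 * s < 3) (C : ℝ≥0) :
    ∃ M : ℝ≥0∞, M ≠ ∞ ∧ ∀ (u : ℕ → 𝓢(E3, ℂ)) (v : ℕ → ℝ → ℝ),
      (∀ k, Continuous (v k)) → (∀ k r, 0 ≤ v k r) → (∀ k r, v k r ≤ 1) →
      (∀ k x, u k x = v k ‖x‖) →
      (∀ k, ∫⁻ ξ : E3, ‖ξ‖ₑ ^ (2 * s) * ‖𝓕 (u k) ξ‖ₑ ^ 2 ≤ C) →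
      (∀ k, ∫⁻ x : E3, ‖x‖ₑ ^ (-(1 / 2) : ℝ) * ‖u k x‖ₑ ^ 2 ≤ C) →
      ∃ φ ∈ coulombSobolev 𝕜 s, coulombSobolevNorm s φ ≤ M ∧
        ∀ x, ‖φ x‖ₑ = ∑' k, (2⁻¹ : ℝ≥0∞) ^ k * ‖u k x‖ₑ := by
  obtain ⟨K, hK⟩ := exists_lintegral_coulomb_le
  have hC8 : (8 * C : ℝ≥0∞) ≠ ∞ := ENNReal.mul_ne_top (by simp) (by simp)
  have hS : (8 * C : ℝ≥0∞) ^ (1 / 2 : ℝ) ≠ ∞ := ENNReal.rpow_ne_top_of_nonneg (by norm_num) hC8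
  have hE : (K * (8 * C) ^ 2 : ℝ≥0∞) ≠ ∞ := ENNReal.mul_ne_top (by simp) (ENNReal.pow_ne_top hC8)
  refine ⟨(((8 * C : ℝ≥0∞) ^ (1 / 2 : ℝ)) ^ 2 + (K * (8 * C) ^ 2 : ℝ≥0∞) ^ (1 / 2 : ℝ)) ^
    (1 / 2 : ℝ), ?_, fun u v hvc hv0 hv1 huv huS huE => ?_⟩
  · exact ENNReal.rpow_ne_top_of_nonneg (by norm_num) (ENNReal.add_ne_top.2
      ⟨ENNReal.pow_ne_top hS, ENNReal.rpow_ne_top_of_nonneg (by norm_num) hE⟩)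
  have hgeo : Summable fun k : ℕ => (2⁻¹ : ℝ) ^ k :=
    summable_geometric_of_lt_one (by norm_num) (by norm_num)
  have hnonneg (k : ℕ) (r : ℝ) : 0 ≤ (2⁻¹ : ℝ) ^ k * v k r := mul_nonneg (by positivity) (hv0 k r)
  have hle (k : ℕ) (r : ℝ) : (2⁻¹ : ℝ) ^ k * v k r ≤ (2⁻¹ : ℝ) ^ k :=
    mul_le_of_le_one_right (by positivity) (hv1 k r)
  have hsum (r : ℝ) : Summable fun k => (2⁻¹ : ℝ) ^ k * v k r :=
    hgeo.of_nonneg_of_le (fun k => hnonneg k r) (fun k => hle k r)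
  let f : ℝ → ℝ := fun r => ∑' k, (2⁻¹ : ℝ) ^ k * v k r
  have hf : Continuous f := continuous_tsum (fun k => (hvc k).const_mul _) hgeo
    fun k r => by rw [Real.norm_of_nonneg (hnonneg k r)]; exact hle k r
  let φ : E3 → 𝕜 := fun x => (f ‖x‖ : 𝕜)
  have hφc : Continuous φ := RCLike.continuous_ofReal.comp (hf.comp continuous_norm)
  have hu_enorm (k : ℕ) (x : E3) : ‖u k x‖ₑ = ENNReal.ofReal (v k ‖x‖) := by
    rw [huv, ← ofReal_norm, Complex.norm_real, Real.norm_of_nonneg (hv0 k _)]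
  have hφ_enorm (x : E3) : ‖φ x‖ₑ = ENNReal.ofReal (f ‖x‖) := by
    rw [← ofReal_norm, RCLike.norm_ofReal, abs_of_nonneg (tsum_nonneg fun k => hnonneg k _)]
  have hφ_tsum (x : E3) : ‖φ x‖ₑ = ∑' k, (2⁻¹ : ℝ≥0∞) ^ k * ‖u k x‖ₑ := by
    rw [hφ_enorm, ENNReal.ofReal_tsum_of_nonneg (fun k => hnonneg k _) (hsum _)]
    refine tsum_congr fun k => ?_
    rw [hu_enorm, ENNReal.ofReal_mul (by positivity), ENNReal.ofReal_pow (by norm_num),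
      ENNReal.ofReal_inv_of_pos (by norm_num), ENNReal.ofReal_ofNat]
  have hSob : homSobolevNorm s φ ≤ (8 * C : ℝ≥0∞) ^ (1 / 2 : ℝ) := by
    refine ENNReal.rpow_le_rpow ?_ (by norm_num)
    have e : (fun x => RCLike.map 𝕜 ℂ (φ x)) = fun x => ∑' k, (2⁻¹ : ℂ) ^ k * u k x := by
      funext x
      rw [RCLike.map_ofReal]
      simp only [f, huv]
      exact (Complex.ofReal_tsum _).trans (tsum_congr fun k => by push_cast; rfl)
    rw [e]
    refine homSobolevSq_tsum_le hs0 hs (fun k x => ?_) ENNReal.coe_ne_top huS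
    rw [huv, Complex.norm_real, Real.norm_of_nonneg (hv0 k _)]
    exact hv1 k _
  have hEn : coulombEnergy φ ≤ K * (8 * C) ^ 2 := by
    have h := hK (fun r => ENNReal.ofReal (f r) ^ 2) (by have := hf.measurable; fun_prop)
    unfold coulombEnergy
    simp only [hφ_enorm]
    refine h.trans ?_
    gcongr
    refine le_trans (le_of_eq (lintegral_congr fun x => ?_))
      (lintegral_mul_tsum_geometric_sq_le (w := fun x : E3 => ‖x‖ₑ ^ (-(1 / 2) : ℝ))
        (by fun_prop) (fun k => (u k).continuous.measurable.enorm) huE)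
    rw [mul_comm, ← hφ_enorm, hφ_tsum]
  refine ⟨φ, ⟨hφc.aestronglyMeasurable, ⟨fun r => (f r : 𝕜), .rfl⟩, hSob.trans_lt hS.lt_top,
    hEn.trans_lt hE.lt_top⟩, ?_, hφ_tsum⟩
  unfold coulombSobolevNorm
  gcongr

theorem exists_lt_ofReal_mul_rpow {c δ : ℝ} (hc : 0 < c) (hδ : 0 < δ) {B : ℝ≥0∞} (hB : B ≠ ∞) :
    ∃ t : ℝ, 2 ≤ t ∧ B < ENNReal.ofReal (c * t ^ δ) := by
  have h := ((tendsto_rpow_atTop hδ).const_mul_atTop hc).eventually_gt_atTop B.toReal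
  obtain ⟨t, h1, h2⟩ := (h.and (Filter.eventually_ge_atTop 2)).exists
  exact ⟨t, h2, (ENNReal.lt_ofReal_iff_toReal_lt hB).2 h1⟩

theorem theorem0p4 {𝕜 : Type*} [RCLike 𝕜] (s p : ℝ) (hs : 1 / 2 < s) (hs' : s ≤ 1)
    (hp : 0 < p) (hp' : p < (16 * s + 2) / (6 * s + 1)) :
    (∃ φ ∈ coulombSobolev 𝕜 s, ¬ MemLp φ (ENNReal.ofReal p) volume) ∧
      ∀ C : ℝ≥0, ∃ φ ∈ coulombSobolev 𝕜 s, MemLp φ (ENNReal.ofReal p) volume ∧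
        (C : ℝ≥0∞) * coulombSobolevNorm s φ < eLpNorm φ (ENNReal.ofReal p) volume := by
  obtain ⟨C₀, c, hc, hbump⟩ := exists_radial_bumps hs hs'
  obtain ⟨M, hM, hsuper⟩ := exists_mem_coulombSobolev_enorm_eq_tsum 𝕜 (s := s)
    (by linarith) (by linarith) C₀
  have hδ : 0 < 8 * s + 1 - (6 * s + 1) / 2 * p := by
    rw [lt_div_iff₀ (by linarith)] at hp'
    nlinarith
  have hp0 : ENNReal.ofReal p ≠ 0 := by simpa using hp
  have hpr : (ENNReal.ofReal p).toReal = p := ENNReal.toReal_ofReal hp.le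
  -- No cancellation: each term of the series bounds `‖φ x‖` from below.
  have hlow {φ : E3 → 𝕜} {u : ℕ → 𝓢(E3, ℂ)}
      (hφ : ∀ x, ‖φ x‖ₑ = ∑' k, (2⁻¹ : ℝ≥0∞) ^ k * ‖u k x‖ₑ) (k : ℕ) :
      ((2⁻¹ : ℝ≥0∞) ^ k) ^ p * ∫⁻ x, ‖u k x‖ₑ ^ p ≤ ∫⁻ x, ‖φ x‖ₑ ^ p := by
    rw [← lintegral_const_mul _ ((u k).continuous.measurable.enorm.pow_const p)]
    refine lintegral_mono fun x => ?_
    rw [← ENNReal.mul_rpow_of_nonneg _ _ hp.le, hφ]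
    gcongr
    exact ENNReal.le_tsum (f := fun k => (2⁻¹ : ℝ≥0∞) ^ k * ‖u k x‖ₑ) k
  choose U V hVc hV0 hV1 hUV hUS hUE hUp using hbump
  constructor
  · have ht (k : ℕ) : ∃ t : ℝ, 2 ≤ t ∧ (k : ℝ≥0∞) * ((2 : ℝ≥0∞) ^ k) ^ p <
        ENNReal.ofReal (c * t ^ (8 * s + 1 - (6 * s + 1) / 2 * p)) :=
      exists_lt_ofReal_mul_rpow hc hδ (ENNReal.mul_ne_top (by simp)
        (ENNReal.rpow_ne_top_of_nonneg hp.le (ENNReal.pow_ne_top (by simp))))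
    choose t ht2 ht using ht
    obtain ⟨φ, hφ, -, hφu⟩ := hsuper (fun k => U (t k) (ht2 k)) (fun k => V (t k) (ht2 k))
      (fun _ => hVc _ _) (fun _ => hV0 _ _) (fun _ => hV1 _ _) (fun _ => hUV _ _)
      (fun _ => hUS _ _) (fun _ => hUE _ _)
    refine ⟨φ, hφ, fun hmem => ?_⟩
    have hfin := (eLpNorm_lt_top_iff_lintegral_rpow_enorm_lt_top hp0 ENNReal.ofReal_ne_top).1 hmem.2
    rw [hpr] at hfin
    obtain ⟨k, hk⟩ := ENNReal.exists_nat_gt hfin.ne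
    refine absurd hk (not_lt.2 ?_)
    calc (k : ℝ≥0∞) = ((2⁻¹ : ℝ≥0∞) ^ k) ^ p * (k * ((2 : ℝ≥0∞) ^ k) ^ p) := by
          rw [mul_left_comm, ← ENNReal.mul_rpow_of_nonneg _ _ hp.le, ← mul_pow,
            ENNReal.inv_mul_cancel (by simp) (by simp)]
          simp
      _ ≤ ((2⁻¹ : ℝ≥0∞) ^ k) ^ p * ∫⁻ x, ‖U (t k) (ht2 k) x‖ₑ ^ p := by
          gcongr
          exact (ht k).le.trans (hUp _ _ p hp)
      _ ≤ _ := hlow hφu k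
  · intro C
    have hB : ((C : ℝ≥0∞) * M) ^ p ≠ ∞ :=
      ENNReal.rpow_ne_top_of_nonneg hp.le (ENNReal.mul_ne_top (by simp) hM)
    obtain ⟨t, ht2, ht⟩ := exists_lt_ofReal_mul_rpow hc hδ hB
    -- A constant sequence of bumps: `‖φ‖` is twice the bump, hence in `L^p`, and the bound `M` does
    -- not depend on `t`.
    obtain ⟨φ, hφ, hφM, hφu⟩ := hsuper (fun _ => U t ht2) (fun _ => V t ht2)
      (fun _ => hVc _ _) (fun _ => hV0 _ _) (fun _ => hV1 _ _) (fun _ => hUV _ _)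
      (fun _ => hUS _ _) (fun _ => hUE _ _)
    refine ⟨φ, hφ, ?_, ?_⟩
    · refine MemLp.of_enorm_le_mul (c := 2) ((U t ht2).memLp _) hφ.1 (.of_forall fun x => ?_)
      rw [hφu, ENNReal.tsum_mul_right, ENNReal.tsum_geometric]
      simp
    · calc (C : ℝ≥0∞) * coulombSobolevNorm s φ ≤ C * M := by gcongr
        _ < (∫⁻ x, ‖φ x‖ₑ ^ p) ^ p⁻¹ := by
          rw [ENNReal.lt_rpow_inv_iff hp]
          refine ht.trans_le ((hUp t ht2 p hp).trans ?_)
          simpa using hlow hφu 0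
        _ = eLpNorm φ (ENNReal.ofReal p) volume := by
          rw [eLpNorm_eq_lintegral_rpow_enorm_toReal hp0 ENNReal.ofReal_ne_top, hpr, one_div]
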